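/- Let $M$ be a connected smooth manifold (Hausdorff, second countable) of dimension $n$, let $2\le q<n$, and let $\mathcal F$ be a smooth codimension-$q$ foliation of $M$, with tangent distribution $T\mathcal F$ and with leaf space $M/\mathcal F$ carrying the quotient topology. Let $g_\intercal$ be a Lorentzian transverse metric for $\mathcal F$: a smooth symmetric $(0,2)$-tensor field on $M$ such that $g_\intercal(v,\cdot)=0$ for $v\in T\mathcal F$, $\mathcal L_Vg_\intercal=0$ for every smooth vector field $V$ tangent to $\mathcal F$, and the form induced by $g_\intercal$ on each fibre $T_xM/T_x\mathcal F$ is nondegenerate of index $1$. Assume that $(M,\mathcal F,g_\intercal)$ is time-oriented: for each $x\in M$ a connected component $\tau^\intercal_+(x)$ of $\{v\in T_xM: g_\intercal(v,v)<0\}$ has been chosen, and near every point there is a smooth vector field with values in the chosen components. A future-directed transversely causal curve is a piecewise smooth curve $\gamma:[a,b]\to M$, $a<b$, whose velocities (one-sided at break points and endpoints) all lie in $\overline{\tau^\intercal_+(\gamma(t))}\setminus T_{\gamma(t)}\mathcal F$. Call $(M,\mathcal F,g_\intercal)$ *transversely strongly causal* if for every leaf $L$ and every open set $\mathcal U\supset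 L$ that is a union of leaves, there is an open set $\mathcal V$ with $L\subset\mathcal V\subset\mathcal U$ such that every future-directed transversely causal curve $\gamma:[a,b]\to M$ with $\gamma(a),\gamma(b)\in\mathcal V$ satisfies $\gamma([a,b])\subset\mathcal U$. Let $g$ be a bundle-like Lorentzian metric on $M$ associated with $g_\intercal$: a smooth Lorentzian metric (index $1$) such that $T_xM=T_x\mathcal F\oplus T_x\mathcal F^{\perp}$ for every $x\in M$ (orthogonality with respect to $g$), and $g_\intercal(v,w)=g(v^\perp,w^\perp)$ for all $x\in M$ and $v,w\in T_xM$, where $v^\perp$ is the component of $v$ in $T_x\mathcal F^\perp$. Give $(M,g)$ the induced time-orientation, i.e. the one whose future timecones satisfy $\tau_+(x)\subset\tau_+^\intercal(x)$ for every $x\in M$. If $(M,\mathcal F,g_\intercal)$ is transversely strongly causal and $M/\mathcal F$ is Hausdorff, then $(M,g)$ is strongly causal: for every $x\in M$ and every open $U\ni x$ there is an open $V$ with $x\in V\subset U$ such that every future-directed $g$-causal piecewise smooth curve $\gamma:[a,b]\to M$ with $\gamma(a),\gamma(b)\in V$ satisfies $\gamma([a,b])\subset U$. -/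

import Mathlib

open scoped Manifold ContDiff

noncomputable section

/-- The model space `ℝᵏ` with its Euclidean norm. -/
abbrev Euc (k : ℕ) : Type := EuclideanSpace ℝ (Fin k)

namespace LorFol

/-! ### Tensor fields and metrics on a manifold -/

section Tensors

variable (n : ℕ) (M : Type*) [TopologicalSpace M] [ChartedSpace (Euc n) M]

/-- A (not necessarily smooth) field of bilinear forms on the tangent spaces of `M`,
i.e. a `(0,2)`-type tensor field. -/
abbrev Tensor02 : Type _ :=
  ∀ x : M, TangentSpace (𝓡 n) x →L[ℝ] TangentSpace (𝓡 n) x →L[ℝ] ℝ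

/-- A (not necessarily smooth) vector field on `M`. -/
abbrev VField : Type _ := ∀ x : M, TangentSpace (𝓡 n) x

/-- A choice of a set of tangent vectors at each point. -/
abbrev ConeField : Type _ := ∀ x : M, Set (TangentSpace (𝓡 n) x)

variable {n M}

/-- Smoothness, on a set `s`, of a vector field. -/
def SmoothVFieldOn [IsManifold (𝓡 n) ∞ M] (X : VField n M) (s : Set M) : Prop :=
  ContMDiffOn (𝓡 n) (𝓡 n).tangent ∞
    (fun x => (Bundle.TotalSpace.mk' (Euc n) x (X x) : TangentBundle (𝓡 n) M)) s

/-- Smoothness and symmetry of a `(0,2)`-type tensor field. -/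
structure IsSmoothSymm [IsManifold (𝓡 n) ∞ M] (b : Tensor02 n M) : Prop where
  smooth : ContMDiff (𝓡 n) ((𝓡 n).prod 𝓘(ℝ, Euc n →L[ℝ] Euc n →L[ℝ] ℝ)) ∞
    (fun x => Bundle.TotalSpace.mk'
      (E := fun x : M => TangentSpace (𝓡 n) x →L[ℝ] TangentSpace (𝓡 n) x →L[ℝ] ℝ)
      (Euc n →L[ℝ] Euc n →L[ℝ] ℝ) x (b x))
  symm : ∀ (x : M) (v w : TangentSpace (𝓡 n) x), b x v w = b x w v

/-- The bilinear form `σ` is nondegenerate of index `μ`, the index being the maximal dimension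
of a subspace on which `σ` is negative definite. -/
def NondegOfIndex {V : Type*} [AddCommGroup V] [Module ℝ V] (σ : LinearMap.BilinForm ℝ V)
    (μ : ℕ) : Prop :=
  σ.Nondegenerate ∧ sigNeg (LinearMap.BilinMap.toQuadraticMap σ) = μ

/-- A Lorentzian metric on the manifold `M` (of dimension at least two). -/
structure IsLorentzMetric [IsManifold (𝓡 n) ∞ M] (g : Tensor02 n M) : Prop where
  two_le_dim : 2 ≤ n
  smoothSymm : IsSmoothSymm g
  index_one : ∀ x : M, NondegOfIndex (ContinuousLinearMap.toLinearMap₁₂ (g x)) 1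

/-- The set of vectors at `x` on which the quadratic form of `b` is negative: the timelike vectors
of a Lorentzian metric, respectively the transversely timelike vectors of a Lorentzian transverse
metric. -/
def timelikeSet (b : Tensor02 n M) (x : M) : Set (TangentSpace (𝓡 n) x) :=
  {v | b x v v < 0}

/-- A time-orientation: at each point one of the connected components of the set of (transversely)
timelike vectors (a timecone, respectively a timewedge), chosen smoothly in the sense that near
each point there is a smooth vector field taking values in the chosen components. -/
structure IsTimeOrientation [IsManifold (𝓡 n) ∞ M] (b : Tensor02 n M) (T : ConeField n M) : Prop where
  component : ∀ x : M, ∃ v ∈ timelikeSet b x, T x = connectedComponentIn (timelikeSet b x) v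
  smooth : ∀ x : M, ∃ U : Set M, IsOpen U ∧ x ∈ U ∧
    ∃ X : VField n M, SmoothVFieldOn X U ∧ ∀ y ∈ U, X y ∈ T y

/-- `γ` restricted to `[a,b]`, `a < b`, is a piecewise smooth curve all of whose velocity vectors
lie in the cone field `C`: there is a partition `a = p 0 < ⋯ < p k = b` such that `γ` is smooth on
each closed piece, with its velocities on that piece, one-sided at the two ends, in `C`. -/
def IsPiecewiseSmoothCurveIn (C : ConeField n M) (γ : ℝ → M) (a b : ℝ) : Prop :=
  a < b ∧ ∃ (k : ℕ) (p : ℕ → ℝ), p 0 = a ∧ p k = b ∧ ∀ i < k, p i < p (i + 1) ∧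
    ContMDiffOn 𝓘(ℝ) (𝓡 n) ∞ γ (Set.Icc (p i) (p (i + 1))) ∧
    ∀ t ∈ Set.Icc (p i) (p (i + 1)),
      (mfderivWithin 𝓘(ℝ) (𝓡 n) γ (Set.Icc (p i) (p (i + 1))) t (1 : ℝ) :
        TangentSpace (𝓡 n) (γ t)) ∈ C (γ t)

/-- The future causal cones `closure (τ⁺) \ {0}` of a time-oriented Lorentzian manifold, where
`T x = τ⁺` is the future timecone at `x`. -/
def futureCausalCone (T : ConeField n M) : ConeField n M :=
  fun x => closure (T x) \ {0}

/-- Strong causality of the Lorentzian manifold `M` with future timecones `T`: every open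
neighbourhood `U` of a point contains an open neighbourhood `V` of that point such that every causal
curve segment with endpoints in `V` stays in `U`. The curves are taken to be future-directed; the
past-directed ones are their reversals and have the same endpoints and image. -/
def IsStronglyCausal (T : ConeField n M) : Prop :=
  ∀ (x : M) (U : Set M), IsOpen U → x ∈ U → ∃ V : Set M, IsOpen V ∧ x ∈ V ∧ V ⊆ U ∧
    ∀ (γ : ℝ → M) (a b : ℝ), IsPiecewiseSmoothCurveIn (futureCausalCone T) γ a b →
      γ a ∈ V → γ b ∈ V → γ '' Set.Icc a b ⊆ U

end Tensors

/-! ### Foliations -/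

/- The manifold structure on `ℝ^q` is the standard one. -/
attribute [local instance 2000] chartedSpaceSelf

/-- A codimension `q` foliation of the `n`-manifold `M`, presented by a Haefliger cocycle: an open
cover `U i`, submersions `π i : U i → ℝ^q`, and smooth transition maps
`γ i j : π j (U i ∩ U j) → π i (U i ∩ U j)` with `γ i j ∘ π j = π i` on `U i ∩ U j`. (By the last
identity for `(i, j)` and `(j, i)` the maps `γ i j` and `γ j i` are mutually inverse bijections, so
they are diffeomorphisms. The values of `π i` and `γ i j` off the indicated sets are irrelevant.) -/
structure Foliation (ι : Type*) (n q : ℕ) (M : Type*) [TopologicalSpace M]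
    [ChartedSpace (Euc n) M] where
  U : ι → Set M
  π : ι → M → Euc q
  γ : ι → ι → Euc q → Euc q
  isOpen_U : ∀ i, IsOpen (U i)
  cover : ∀ x : M, ∃ i, x ∈ U i
  smooth_π : ∀ i, ContMDiffOn (𝓡 n) (𝓡 q) ∞ (π i) (U i)
  submersion : ∀ i, ∀ x ∈ U i, Function.Surjective (mfderiv (𝓡 n) (𝓡 q) (π i) x)
  smooth_γ : ∀ i j, ContDiffOn ℝ ∞ (γ i j) (π j '' (U i ∩ U j))
  cocycle : ∀ i j, ∀ x ∈ U i ∩ U j, γ i j (π j x) = π i x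

namespace Foliation

variable {ι : Type*} {n q : ℕ} {M : Type*} [TopologicalSpace M] [ChartedSpace (Euc n) M]

/-- `y` lies in the plaque of `x` in some `U i`, the plaques being the connected components of the
fibres of `π i : U i → ℝ^q`. -/
def SamePlaque (F : Foliation ι n q M) (x y : M) : Prop :=
  ∃ i, x ∈ F.U i ∧ y ∈ connectedComponentIn (F.U i ∩ F.π i ⁻¹' {F.π i x}) x

/-- Two points are on the same leaf if they are joined by a finite chain of plaques. -/
def leafSetoid (F : Foliation ι n q M) : Setoid M := Relation.EqvGen.setoid F.SamePlaque

/-- The leaf through `x`. -/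
def leaf (F : Foliation ι n q M) (x : M) : Set M := {y | F.leafSetoid x y}

/-- The leaf space `M/F`; it carries the quotient topology. -/
abbrev LeafSpace (F : Foliation ι n q M) : Type _ := Quotient F.leafSetoid

/-- A set is saturated if it is a union of leaves. -/
def IsSaturated (F : Foliation ι n q M) (A : Set M) : Prop := ∀ x ∈ A, F.leaf x ⊆ A

/-- The tangent space `T_xF` of the leaf through `x`: the kernel of the differential at `x` of any
submersion `π i` of the cocycle with `x ∈ U i` (these kernels all agree). -/
def tangent (F : Foliation ι n q M) (x : M) : Submodule ℝ (TangentSpace (𝓡 n) x) :=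
  ⨅ (i : ι) (_ : x ∈ F.U i), LinearMap.ker (mfderiv (𝓡 n) (𝓡 q) (F.π i) x).toLinearMap

theorem mem_tangent (F : Foliation ι n q M) (x : M) (v : TangentSpace (𝓡 n) x) :
    v ∈ F.tangent x ↔ ∀ i, x ∈ F.U i → mfderiv (𝓡 n) (𝓡 q) (F.π i) x v = 0 := by
  unfold tangent
  rw [Submodule.mem_iInf]
  refine forall_congr' fun i => ?_
  rw [Submodule.mem_iInf]
  rfl

/-- A Lorentzian transverse metric for the foliation `F`, of codimension `2 ≤ q < n`: a smooth
symmetric `(0,2)`-type tensor field that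
* is basic, i.e. vanishes when one argument is tangent to the leaves, and has zero Lie derivative
  along all vector fields tangent to the leaves;
* induces on each fibre `T_xM / T_xF` of the normal bundle a nondegenerate form of index one. -/
structure IsLorentzTransverseMetric [IsManifold (𝓡 n) ∞ M] (F : Foliation ι n q M)
    (gT : Tensor02 n M) : Prop where
  two_le_codim : 2 ≤ q
  codim_lt_dim : q < n
  smoothSymm : IsSmoothSymm gT
  vertical : ∀ (x : M) (v w : TangentSpace (𝓡 n) x), v ∈ F.tangent x → gT x v w = 0
  invariant : ∀ V X Y : VField n M, SmoothVFieldOn V Set.univ → SmoothVFieldOn X Set.univ →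
    SmoothVFieldOn Y Set.univ → (∀ x, V x ∈ F.tangent x) → ∀ x : M,
      mfderiv (𝓡 n) 𝓘(ℝ) (fun y => gT y (X y) (Y y)) x (V x) =
        gT x (VectorField.mlieBracket (𝓡 n) V X x) (Y x) +
          gT x (X x) (VectorField.mlieBracket (𝓡 n) V Y x)
  index_one : ∀ x : M, ∃ σ : LinearMap.BilinForm ℝ (TangentSpace (𝓡 n) x ⧸ F.tangent x),
    (∀ v w : TangentSpace (𝓡 n) x,
      σ ((F.tangent x).mkQ v) ((F.tangent x).mkQ w) = gT x v w) ∧ NondegOfIndex σ 1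

/-- The orthogonal space `T_xF^⊥` with respect to `g`. -/
def orthogonal (F : Foliation ι n q M) (g : Tensor02 n M) (x : M) :
    Submodule ℝ (TangentSpace (𝓡 n) x) where
  carrier := {w | ∀ v ∈ F.tangent x, g x v w = 0}
  zero_mem' := by
    intro v _
    simp
  add_mem' := by
    intro w w' hw hw' v hv
    rw [map_add, hw v hv, hw' v hv, add_zero]
  smul_mem' := by
    intro c w hw v hv
    rw [map_smul, hw v hv, smul_zero]

/-- The metric `g` is bundle-like for `F` with associated transverse metric `gT`: the tangent spaces
split as `T_xM = T_xF ⊕ T_xF^⊥`, and `gT v w = g v^⊥ w^⊥`, where `v^⊥` and `w^⊥` are the horizontal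
parts of `v` and `w` in this splitting. -/
structure IsBundleLike (F : Foliation ι n q M) (gT g : Tensor02 n M) : Prop where
  adapted : ∀ x : M, IsCompl (F.tangent x) (F.orthogonal g x)
  associated : ∀ (x : M) (v w v' w' : TangentSpace (𝓡 n) x),
    v' ∈ F.orthogonal g x → v - v' ∈ F.tangent x →
    w' ∈ F.orthogonal g x → w - w' ∈ F.tangent x → gT x v w = g x v' w'

/-- The (transversely) future-directed transversely causal vectors, i.e. the future causal wedges,
where `T x` is the future timewedge at `x`: the vectors of `closure (T x)` (on which
`gT v v ≤ 0`) that are not tangent to the leaves. -/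
def futureCausalWedge (F : Foliation ι n q M) (T : ConeField n M) : ConeField n M :=
  fun x => closure (T x) \ (F.tangent x : Set (TangentSpace (𝓡 n) x))

/-- Transverse strong causality of the foliation, time-oriented by the future timewedges `T`. As for
`IsStronglyCausal`, the transversely causal curves are taken to be future-directed. -/
def IsTransverselyStronglyCausal (F : Foliation ι n q M) (T : ConeField n M) : Prop :=
  ∀ (x : M) (U : Set M), IsOpen U → F.IsSaturated U → F.leaf x ⊆ U →
    ∃ V : Set M, IsOpen V ∧ F.leaf x ⊆ V ∧ V ⊆ U ∧
      ∀ (γ : ℝ → M) (a b : ℝ), IsPiecewiseSmoothCurveIn (F.futureCausalWedge T) γ a b →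
        γ a ∈ V → γ b ∈ V → γ '' Set.Icc a b ⊆ U

end Foliation

end LorFol

end

/-! Future causal vectors of `g` are transversely causal, so transverse strong causality confines a
causal curve with endpoints near the leaf L of x to any prescribed saturated neighbourhood of L.
This does not yet stop the curve from drifting along the leaf direction. A local temporal function
does: the horizontal part w of a future timelike vector at x is timelike, and -g(w, ·) kills the
leaf directions, hence equals l ∘ dπ_i for a linear form l on ℝ^q. The function f = l ∘ π_i is
constant on plaques, and near x its derivative is at least c times the chart norm on future causal
vectors (`exists_chartForm_temporal`). A causal curve going from inside chart radius r out to radius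
2r therefore gains at least c * r in f (`le_sub`).

Suppose no V works, and let s lie slightly above f(x). If f does not take the value s on L ∩ U_i,
the slice f = s of the chart ball is compact and misses L, so the Hausdorff leaf space provides a
saturated open W ⊇ L disjoint from the slice. A bad curve that starts and ends near x is trapped in
W but has to cross the slice, a contradiction. Hence f takes on L ∩ U_i every value in an interval.
But L meets U_i in only countably many fibres of π_i (`countable_image_leaf`). -/

noncomputable section

namespace LorFol

/-! ### Forms of index one. -/

section LinearAlgebra

variable {V : Type*} [AddCommGroup V] [Module ℝ V] [FiniteDimensional ℝ V]
  {σ : LinearMap.BilinForm ℝ V}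

/-- A symmetric form of index one is not negative definite on a plane. -/
theorem nonneg_of_orthogonal_of_index_one (hs : ∀ v w, σ v w = σ w v) (hσ : NondegOfIndex σ 1)
    {y v : V} (hy : σ y y < 0) (hyv : σ y v = 0) : 0 ≤ σ v v := by
  by_contra! hv
  have hli : LinearIndependent ℝ ![y, v] := by
    rw [LinearIndependent.pair_iff]
    intro s t hst
    have h1 : σ y (s • y + t • v) = 0 := by rw [hst, map_zero]
    have h2 : σ v (s • y + t • v) = 0 := by rw [hst, map_zero]
    simp only [map_add, map_smul, smul_eq_mul, hyv, hs v y, mul_zero, add_zero, zero_add] at h1 h2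
    exact ⟨(mul_eq_zero.1 h1).resolve_right hy.ne, (mul_eq_zero.1 h2).resolve_right hv.ne⟩
  have hdim := finrank_span_eq_card hli
  have hneg : ((-LinearMap.BilinMap.toQuadraticMap σ).restrict
      (Submodule.span ℝ (Set.range ![y, v]))).PosDef := by
    rintro ⟨w, hw⟩ hw0
    rw [Matrix.range_cons, Matrix.range_cons, Matrix.range_empty, Set.union_empty,
      Set.singleton_union, Submodule.mem_span_pair] at hw
    obtain ⟨s, t, rfl⟩ := hw
    have hst : s ≠ 0 ∨ t ≠ 0 := by
      by_contra! h
      exact hw0 (by simp [h.1, h.2])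
    have : σ (s • y + t • v) (s • y + t • v) < 0 := by
      simp only [map_add, map_smul, LinearMap.add_apply, LinearMap.smul_apply, smul_eq_mul, hyv,
        hs v y, mul_zero, add_zero, zero_add]
      rcases hst with h | h
      · nlinarith [mul_pos_of_neg_of_neg (neg_neg_of_pos (sq_pos_of_ne_zero h)) hy,
          mul_nonneg (sq_nonneg t) (neg_nonneg.2 hv.le)]
      · nlinarith [mul_pos_of_neg_of_neg (neg_neg_of_pos (sq_pos_of_ne_zero h)) hv,
          mul_nonneg (sq_nonneg s) (neg_nonneg.2 hy.le)]
    exact neg_pos.2 this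
  have := le_sigNeg_of_negDef _ hneg
  rw [hσ.2, hdim] at this
  simp at this

/-- In a Lorentzian vector space, the orthogonal space of a timelike vector is spacelike. -/
theorem pos_of_orthogonal_of_index_one (hs : ∀ v w, σ v w = σ w v) (hσ : NondegOfIndex σ 1)
    {y v : V} (hy : σ y y < 0) (hyv : σ y v = 0) (hv : v ≠ 0) : 0 < σ v v := by
  refine (nonneg_of_orthogonal_of_index_one hs hσ hy hyv).lt_of_ne' fun hv0 => hv ?_
  refine hσ.1.1 v fun w => ?_
  by_contra hw
  -- The form is nonnegative on the orthogonal space of y. Projecting w there leaves its product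
  -- with v unchanged, so a null v pairing nontrivially with w makes the form negative at some v + t
  -- u.
  set u : V := w - (σ y w / σ y y) • y with hu
  have hyu : σ y u = 0 := by
    simp only [hu, map_sub, map_smul, smul_eq_mul]
    rw [div_mul_cancel₀ _ hy.ne, sub_self]
  have hvu : σ v u = σ v w := by
    simp [hu, hs v y, hyv]
  have key : ∀ t : ℝ, 0 ≤ 2 * t * σ v w + t * t * σ u u := by
    intro t
    have := nonneg_of_orthogonal_of_index_one hs hσ hy (v := v + t • u) (by simp [hyv, hyu])
    simp only [map_add, map_smul, LinearMap.add_apply, LinearMap.smul_apply, smul_eq_mul, hv0,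
      hs u v, hvu] at this
    linarith
  have hb : 0 ≤ σ u u := nonneg_of_orthogonal_of_index_one hs hσ hy hyu
  have hpos : 0 < σ v w ^ 2 := by positivity
  -- A nearly minimizing t; the + 1 covers the case `σ u u = 0`.
  have h1 := key (-σ v w / (σ u u + 1))
  have h2 : 2 * (-σ v w / (σ u u + 1)) * σ v w +
      -σ v w / (σ u u + 1) * (-σ v w / (σ u u + 1)) * σ u u =
      -(σ v w ^ 2 * (σ u u + 2)) / (σ u u + 1) ^ 2 := by
    field_simp
    ring
  rw [h2] at h1
  have : 0 < σ v w ^ 2 * (σ u u + 2) / (σ u u + 1) ^ 2 := by positivity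
  rw [neg_div] at h1
  linarith

theorem continuous_apply_self {E : Type*} [NormedAddCommGroup E] [NormedSpace ℝ E]
    (b : E →L[ℝ] E →L[ℝ] ℝ) : Continuous fun v => b v v :=
  b.continuous.clm_apply continuous_id

end LinearAlgebra

/-! ### Timecones and their closures. -/

section Timecones

variable {n : ℕ} {M : Type*} [TopologicalSpace M] [ChartedSpace (Euc n) M]
  [IsManifold (𝓡 n) ∞ M] {g : Tensor02 n M} {T : ConeField n M}

instance (x : M) : FiniteDimensional ℝ (TangentSpace (𝓡 n) x) :=
  inferInstanceAs (FiniteDimensional ℝ (Euc n))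

theorem IsLorentzMetric.pos_of_orthogonal (hg : IsLorentzMetric g) {x : M}
    {y v : TangentSpace (𝓡 n) x} (hy : g x y y < 0) (hyv : g x y v = 0) (hv : v ≠ 0) :
    0 < g x v v :=
  pos_of_orthogonal_of_index_one (σ := ContinuousLinearMap.toLinearMap₁₂ (g x))
    (hg.smoothSymm.symm x) (hg.index_one x) hy hyv hv

theorem IsTimeOrientation.subset_timelikeSet {b : Tensor02 n M} (hT : IsTimeOrientation b T)
    (x : M) : T x ⊆ timelikeSet b x := by
  obtain ⟨v, -, hv⟩ := hT.component x
  rw [hv]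
  exact connectedComponentIn_subset _ _

/-- A timelike vector whose product with one vector of a timecone is negative has negative
product with all vectors of that timecone. -/
theorem IsTimeOrientation.neg_of_mem (hg : IsLorentzMetric g) (hT : IsTimeOrientation g T) {x : M}
    {y v w : TangentSpace (𝓡 n) x} (hy : g x y y < 0) (hv : v ∈ T x) (hyv : g x y v < 0)
    (hw : w ∈ T x) : g x y w < 0 := by
  obtain ⟨u, -, hu⟩ := hT.component x
  have hconn : IsPreconnected (T x) := hu ▸ isPreconnected_connectedComponentIn
  by_contra! h
  -- A change of sign on the connected timecone would produce a timelike z orthogonal to the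
  -- timelike y.
  obtain ⟨z, hz, hz0⟩ := hconn.intermediate_value hv hw (g x y).continuous.continuousOn
    ⟨hyv.le, h⟩
  have hz' : g x z z < 0 := hT.subset_timelikeSet x hz
  have hne : z ≠ 0 := by
    rintro rfl
    simp at hz'
  exact (hg.pos_of_orthogonal hy hz0 hne).not_gt hz'

/-- Both inequalities are closed conditions valid on the timecone. They replace the connected
component by quadratic and linear conditions that vary continuously with the point. -/
theorem IsTimeOrientation.nonpos_of_mem_closure (hg : IsLorentzMetric g)
    (hT : IsTimeOrientation g T) {x : M} {y v w : TangentSpace (𝓡 n) x} (hy : g x y y < 0)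
    (hv : v ∈ T x) (hyv : g x y v < 0) (hw : w ∈ closure (T x)) :
    g x w w ≤ 0 ∧ g x y w ≤ 0 := by
  constructor
  · refine closure_minimal (s := T x) (t := {w | g x w w ≤ 0})
      (fun w hw => le_of_lt (show g x w w < 0 from hT.subset_timelikeSet x hw)) ?_ hw
    exact isClosed_le (continuous_apply_self (E := Euc n) (g x)) continuous_const
  · refine closure_minimal (s := T x) (t := {w | g x y w ≤ 0})
      (fun w hw => (hT.neg_of_mem hg hy hv hyv hw).le) ?_ hw
    exact isClosed_le (g x y).continuous continuous_const

end Timecones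

attribute [local instance 2000] chartedSpaceSelf

/-! ### Plaques, countability of leaves, tangent spaces. -/

namespace Foliation

variable {ι : Type*} {n q : ℕ} {M : Type*} [TopologicalSpace M] [ChartedSpace (Euc n) M]

/-- Membership in a union of fibres of charts of the cocycle that is invariant under the transition
maps is constant along plaques. -/
theorem SamePlaque.mem_iff {F : Foliation ι n q M} {J : Set ι}
    (hJ : ∀ x, ∃ j ∈ J, x ∈ F.U j) {S : Set (ι × Euc q)}
    (hS : ∀ p ∈ S, ∀ j ∈ J, (j, F.γ j p.1 p.2) ∈ S) {x y : M} (h : F.SamePlaque x y) :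
    (∃ j ∈ J, x ∈ F.U j ∧ (j, F.π j x) ∈ S) ↔ ∃ j ∈ J, y ∈ F.U j ∧ (j, F.π j y) ∈ S := by
  obtain ⟨i, hx, hy⟩ := h
  set C := connectedComponentIn (F.U i ∩ F.π i ⁻¹' {F.π i x}) x with hC
  have hCsub : C ⊆ F.U i ∩ F.π i ⁻¹' {F.π i x} := connectedComponentIn_subset _ _
  have hxC : x ∈ C := mem_connectedComponentIn ⟨hx, rfl⟩
  have hconn : IsPreconnected C := isPreconnected_connectedComponentIn
  have hval : ∀ z ∈ C, ∀ j, z ∈ F.U j → F.π j z = F.γ j i (F.π i x) := by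
    intro z hz j hj
    rw [← F.cocycle j i z ⟨hj, (hCsub hz).1⟩, show F.π i z = F.π i x from (hCsub hz).2]
  have hind : ∀ z ∈ C, ∀ j ∈ J, z ∈ F.U j → ∀ k ∈ J, z ∈ F.U k →
      (j, F.π j z) ∈ S → (k, F.π k z) ∈ S := by
    intro z _ j _ hzj k hk hzk h
    have := hS _ h k hk
    rwa [show F.γ k (j, F.π j z).1 (j, F.π j z).2 = F.π k z from
      F.cocycle k j z ⟨hzk, hzj⟩] at this
  -- On the plaque each π_j is constant, so membership in S depends on j alone. Thus A and B are
  -- open, cover the plaque and are disjoint on it; connectedness leaves only one of them.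
  set A : Set M := ⋃ j ∈ {j ∈ J | (j, F.γ j i (F.π i x)) ∈ S}, F.U j
  set B : Set M := ⋃ j ∈ {j ∈ J | (j, F.γ j i (F.π i x)) ∉ S}, F.U j
  have hA : IsOpen A := isOpen_biUnion fun j _ => F.isOpen_U j
  have hB : IsOpen B := isOpen_biUnion fun j _ => F.isOpen_U j
  have hmemA : ∀ z ∈ C, z ∈ A ↔ ∃ j ∈ J, z ∈ F.U j ∧ (j, F.π j z) ∈ S := by
    intro z hz
    simp only [A, Set.mem_iUnion, Set.mem_ofPred_eq]
    constructor
    · rintro ⟨j, ⟨hj, hjS⟩, hzj⟩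
      exact ⟨j, hj, hzj, by rwa [hval z hz j hzj]⟩
    · rintro ⟨j, hj, hzj, hjS⟩
      exact ⟨j, ⟨hj, by rwa [hval z hz j hzj] at hjS⟩, hzj⟩
  have hmemB : ∀ z ∈ C, z ∈ B → z ∉ A := by
    intro z hz hzB hzA
    simp only [B, Set.mem_iUnion, Set.mem_ofPred_eq] at hzB
    obtain ⟨k, ⟨hk, hkS⟩, hzk⟩ := hzB
    obtain ⟨j, hj, hzj, hjS⟩ := (hmemA z hz).1 hzA
    have := hind z hz j hj hzj k hk hzk hjS
    rw [hval z hz k hzk] at this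
    exact hkS this
  have hcov : C ⊆ A ∪ B := by
    intro z hz
    obtain ⟨j, hj, hzj⟩ := hJ z
    by_cases h : (j, F.γ j i (F.π i x)) ∈ S
    · exact Or.inl (Set.mem_biUnion (x := j) ⟨hj, h⟩ hzj)
    · exact Or.inr (Set.mem_biUnion (x := j) ⟨hj, h⟩ hzj)
  have key : ∀ z ∈ C, ∀ w ∈ C, z ∈ A → w ∈ A := by
    intro z hz w hw hzA
    by_contra hwA
    obtain ⟨u, hu, huA, huB⟩ := hconn A B hA hB hcov ⟨z, hz, hzA⟩
      ⟨w, hw, (hcov hw).resolve_left hwA⟩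
    exact hmemB u hu huB huA
  rw [← hmemA x hxC, ← hmemA y hy]
  exact ⟨key x hxC y hy, key y hy x hxC⟩

/-- A leaf of a foliation of a second countable manifold meets the domain of each submersion of the
cocycle in countably many fibres. -/
theorem countable_image_leaf [SecondCountableTopology M] (F : Foliation ι n q M) (i : ι) (x : M) :
    (F.π i '' (F.leaf x ∩ F.U i)).Countable := by
  obtain ⟨J, hJc, hJu⟩ := TopologicalSpace.isOpen_iUnion_countable F.U F.isOpen_U
  have hJ : ∀ y, ∃ j ∈ J, y ∈ F.U j := by
    intro y
    obtain ⟨j, hj⟩ := F.cover y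
    have : y ∈ ⋃ j ∈ J, F.U j := hJu ▸ Set.mem_iUnion.2 ⟨j, hj⟩
    simpa using this
  obtain ⟨j₀, hj₀, hx⟩ := hJ x
  have : Countable J := hJc.to_subtype
  -- All values reachable from x by words of transition maps. Off their domains the maps give junk,
  -- which merely enlarges a set that stays countable.
  let f : List J → ι × Euc q := fun l =>
    l.foldr (fun j p => ((j : ι), F.γ j p.1 p.2)) (j₀, F.π j₀ x)
  have hS : ∀ p ∈ Set.range f, ∀ j ∈ J, (j, F.γ j p.1 p.2) ∈ Set.range f := by
    rintro _ ⟨l, rfl⟩ j hj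
    exact ⟨⟨j, hj⟩ :: l, rfl⟩
  have hleaf : ∀ y z, F.leafSetoid y z →
      ((∃ j ∈ J, y ∈ F.U j ∧ (j, F.π j y) ∈ Set.range f) ↔
        ∃ j ∈ J, z ∈ F.U j ∧ (j, F.π j z) ∈ Set.range f) := by
    intro y z h
    induction h with
    | rel _ _ h => exact h.mem_iff hJ hS
    | refl => rfl
    | symm _ _ _ ih => exact ih.symm
    | trans _ _ _ _ _ ih₁ ih₂ => exact ih₁.trans ih₂
  -- One more transition is needed because i itself may lie outside J.
  refine (Set.countable_range fun l => F.γ i (f l).1 (f l).2).mono ?_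
  rintro _ ⟨y, ⟨hy, hyi⟩, rfl⟩
  obtain ⟨j, -, hyj, l, hl⟩ := (hleaf x y hy).1 ⟨j₀, hj₀, hx, [], rfl⟩
  refine ⟨l, ?_⟩
  simp only [hl]
  exact F.cocycle i j y ⟨hyi, hyj⟩

/-- The tangent spaces of the leaves are the kernels of the differentials of the submersions of the
cocycle. -/
theorem mem_tangent_of_mfderiv_eq_zero (F : Foliation ι n q M) {i : ι} {x : M} (hx : x ∈ F.U i)
    {v : TangentSpace (𝓡 n) x} (hv : mfderiv (𝓡 n) (𝓡 q) (F.π i) x v = 0) : v ∈ F.tangent x := by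
  rw [mem_tangent]
  intro j hj
  have hopen : IsOpen (F.U j ∩ F.U i) := (F.isOpen_U j).inter (F.isOpen_U i)
  have hnhds : F.U j ∩ F.U i ∈ nhds x := hopen.mem_nhds ⟨hj, hx⟩
  have hi : MDifferentiableAt (𝓡 n) (𝓡 q) (F.π i) x :=
    ((F.smooth_π i).contMDiffAt ((F.isOpen_U i).mem_nhds hx)).mdifferentiableAt (by simp)
  -- A derivative within the image suffices: any factorization of dπ_j through dπ_i gives the
  -- inclusion of kernels, so openness of the image is not needed.
  have hγ : HasMFDerivWithinAt (𝓡 q) (𝓡 q) (F.γ j i) (F.π i '' (F.U j ∩ F.U i)) (F.π i x)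
      (fderivWithin ℝ (F.γ j i) (F.π i '' (F.U j ∩ F.U i)) (F.π i x)) :=
    (((F.smooth_γ j i).differentiableOn (by simp)) _
      ⟨x, ⟨hj, hx⟩, rfl⟩).hasFDerivWithinAt.hasMFDerivWithinAt
  have hcomp := hγ.comp x hi.hasMFDerivAt.hasMFDerivWithinAt (Set.subset_preimage_image _ _)
  have heq : HasMFDerivWithinAt (𝓡 n) (𝓡 q) (F.π j) (F.U j ∩ F.U i) x _ :=
    hcomp.congr_of_eventuallyEq (f₁ := F.π j)
      (Filter.eventually_of_mem self_mem_nhdsWithin fun y hy => (F.cocycle j i y hy).symm)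
      (F.cocycle j i x ⟨hj, hx⟩).symm
  rw [(heq.hasMFDerivAt hnhds).mfderiv]
  exact (congrArg (fderivWithin ℝ (F.γ j i) (F.π i '' (F.U j ∩ F.U i)) (F.π i x)) hv).trans
    (map_zero _)

end Foliation

/-! ### Growth along piecewise smooth curves. -/

section PiecewiseSmooth

variable {n : ℕ} {M : Type*} [TopologicalSpace M] [ChartedSpace (Euc n) M]
  {C : ConeField n M} {γ : ℝ → M} {a b : ℝ}

theorem IsPiecewiseSmoothCurveIn.mono {C' : ConeField n M} (h : IsPiecewiseSmoothCurveIn C γ a b)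
    (hC : ∀ x, C x ⊆ C' x) : IsPiecewiseSmoothCurveIn C' γ a b := by
  obtain ⟨hab, k, p, h0, hk, hp⟩ := h
  exact ⟨hab, k, p, h0, hk, fun i hi =>
    ⟨(hp i hi).1, (hp i hi).2.1, fun t ht => hC _ ((hp i hi).2.2 t ht)⟩⟩

theorem IsPiecewiseSmoothCurveIn.continuousOn (h : IsPiecewiseSmoothCurveIn C γ a b) :
    ContinuousOn γ (Set.Icc a b) := by
  obtain ⟨hab, k, p, rfl, rfl, hp⟩ := h
  have key : ∀ j ≤ k, p 0 ≤ p j ∧ ContinuousOn γ (Set.Icc (p 0) (p j)) := by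
    intro j
    induction j with
    | zero => simp
    | succ j ih =>
      intro hj
      obtain ⟨hle, hc⟩ := ih (by omega)
      obtain ⟨hlt, hs, -⟩ := hp j (by omega)
      refine ⟨hle.trans hlt.le, ?_⟩
      rw [← Set.Icc_union_Icc_eq_Icc hle hlt.le]
      exact hc.union_of_isClosed hs.continuousOn isClosed_Icc isClosed_Icc
  exact (key k le_rfl).2

/-- At a break point the piece to the right is used. Right derivatives are all that the mean value
inequality in `le_sub` requires. -/
theorem IsPiecewiseSmoothCurveIn.exists_hasMFDerivWithinAt_Ici
    (h : IsPiecewiseSmoothCurveIn C γ a b) {t : ℝ} (ht : t ∈ Set.Ico a b) :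
    ∃ L : TangentSpace 𝓘(ℝ) t →L[ℝ] TangentSpace (𝓡 n) (γ t),
      L (1 : ℝ) ∈ C (γ t) ∧ HasMFDerivWithinAt 𝓘(ℝ) (𝓡 n) γ (Set.Ici t) t L := by
  obtain ⟨hab, k, p, rfl, rfl, hp⟩ := h
  have key : ∀ j ≤ k, t < p j → ∃ i < k, t ∈ Set.Ico (p i) (p (i + 1)) := by
    intro j
    induction j with
    | zero => exact fun _ h => absurd h ht.1.not_gt
    | succ j ih =>
      intro hj htj
      rcases lt_or_ge t (p j) with h | h
      · exact ih (by omega) h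
      · exact ⟨j, by omega, h, htj⟩
  obtain ⟨i, hi, hti⟩ := key k le_rfl ht.2
  obtain ⟨-, hs, hv⟩ := hp i hi
  have htI : t ∈ Set.Icc (p i) (p (i + 1)) := Set.Ico_subset_Icc_self hti
  refine ⟨_, hv t htI, ?_⟩
  refine ((hs.mdifferentiableOn (by simp)) t htI).hasMFDerivWithinAt.mono_of_mem_nhdsWithin ?_
  exact Icc_mem_nhdsGE_of_mem hti

/-- The differential at `y` of the preferred chart at `x`, as a map into the model space. -/
def chartDeriv (x y : M) : TangentSpace (𝓡 n) y →L[ℝ] Euc n :=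
  mfderiv (𝓡 n) 𝓘(ℝ, Euc n) (extChartAt (𝓡 n) x) y

variable [IsManifold (𝓡 n) ∞ M]

theorem hasMFDerivAt_chartDeriv {x y : M} (hy : y ∈ (chartAt (Euc n) x).source) :
    HasMFDerivAt (𝓡 n) 𝓘(ℝ, Euc n) (extChartAt (𝓡 n) x) y (chartDeriv x y) :=
  (mdifferentiableAt_extChartAt hy).hasMFDerivAt

/-- A function whose derivative along the curve dominates the chart speed grows at least as fast as
the chart distance. -/
theorem IsPiecewiseSmoothCurveIn.le_sub (h : IsPiecewiseSmoothCurveIn C γ a b) {x : M}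
    {f : Euc n → ℝ} {c : ℝ} (hc : 0 < c) {t₁ : ℝ} (ht₁ : t₁ ∈ Set.Icc a b)
    (hsource : ∀ t ∈ Set.Icc a t₁, γ t ∈ (chartAt (Euc n) x).source)
    (hf : ∀ t ∈ Set.Icc a t₁, DifferentiableAt ℝ f (extChartAt (𝓡 n) x (γ t)))
    (hle : ∀ t ∈ Set.Icc a t₁, ∀ v ∈ C (γ t),
      c * ‖chartDeriv x (γ t) v‖ ≤
        fderiv ℝ f (extChartAt (𝓡 n) x (γ t)) (chartDeriv x (γ t) v)) :
    c * ‖extChartAt (𝓡 n) x (γ t₁) - extChartAt (𝓡 n) x (γ a)‖ ≤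
      f (extChartAt (𝓡 n) x (γ t₁)) - f (extChartAt (𝓡 n) x (γ a)) := by
  set β : ℝ → Euc n := fun t => extChartAt (𝓡 n) x (γ t) with hβ
  have hβc : ContinuousOn β (Set.Icc a t₁) :=
    (continuousOn_extChartAt x).comp (h.continuousOn.mono (Set.Icc_subset_Icc_right ht₁.2))
      fun t ht => by simpa using hsource t ht
  have hfc : ContinuousOn (fun t => f (β t)) (Set.Icc a t₁) := fun t ht =>
    ContinuousAt.comp_continuousWithinAt (f := β) (hf t ht).continuousAt (hβc t ht)
  have hderiv : ∀ t ∈ Set.Ico a t₁, ∃ v ∈ C (γ t), HasDerivWithinAt β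
      (chartDeriv x (γ t) v) (Set.Ici t) t := by
    intro t ht
    obtain ⟨L, hL, hL'⟩ := h.exists_hasMFDerivWithinAt_Ici ⟨ht.1, ht.2.trans_le ht₁.2⟩
    refine ⟨_, hL, ?_⟩
    have hD := (hasMFDerivAt_chartDeriv
      (hsource t (Set.Ico_subset_Icc_self ht))).comp_hasMFDerivWithinAt t hL'
    let D : ℝ →L[ℝ] Euc n := (chartDeriv x (γ t)).comp L
    have hF : HasFDerivWithinAt β D (Set.Ici t) t :=
      hasMFDerivWithinAt_iff_hasFDerivWithinAt.1 hD
    exact hF.hasDerivWithinAt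
  choose! v hv hd using hderiv
  have hfd : ∀ t ∈ Set.Ico a t₁, HasDerivWithinAt (fun t => f (β t)) (fderiv ℝ f (β t)
      (chartDeriv x (γ t) (v t))) (Set.Ici t) t := by
    intro t ht
    exact (hf t (Set.Ico_subset_Icc_self ht)).hasFDerivAt.comp_hasDerivWithinAt t (hd t ht)
  -- The norm of c times the chart displacement is compared with the gain of f; both vanish at a.
  have key := image_norm_le_of_norm_deriv_right_le_deriv_boundary'
    (f := fun t => c • (β t - β a)) (B := fun t => f (β t) - f (β a))
    ((hβc.sub continuousOn_const).const_smul c)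
    (fun t ht => ((hd t ht).sub_const _).const_smul c) (by simp)
    (hfc.sub continuousOn_const) (fun t ht => (hfd t ht).sub_const _)
    (fun t ht => by
      rw [norm_smul, Real.norm_of_nonneg hc.le]
      exact hle t (Set.Ico_subset_Icc_self ht) _ (hv t ht)) (Set.right_mem_Icc.2 ht₁.1)
  rwa [norm_smul, Real.norm_of_nonneg hc.le] at key

end PiecewiseSmooth

/-! ### Uniform positivity on nearby cones. -/

section ConeEstimate

/-- A linear form that is positive on a cone defined by quadratic inequalities dominates the norm on
all nearby cones. -/
theorem exists_eventually_mul_norm_le {E X : Type*} [NormedAddCommGroup E] [NormedSpace ℝ E]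
    [FiniteDimensional ℝ E] [TopologicalSpace X] {x : X} {G : X → E →L[ℝ] E →L[ℝ] ℝ}
    (hG : ContinuousAt G x) {A : X → E →L[ℝ] ℝ} (hA : ContinuousAt A x) (w : E)
    (hpos : ∀ u, u ≠ 0 → G x u u ≤ 0 → G x w u ≤ 0 → 0 < A x u) :
    ∃ c > 0, ∀ᶠ y in nhds x, ∀ u, G y u u ≤ 0 → G y w u ≤ 0 → c * ‖u‖ ≤ A y u := by
  have hcompact : IsCompact (Metric.sphere (0 : E) 1) := isCompact_sphere 0 1
  set K : Set E := Metric.sphere 0 1 ∩ {u | G x u u ≤ 0 ∧ G x w u ≤ 0} with hK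
  have hKc : IsCompact K := hcompact.inter_right <|
    (isClosed_le (continuous_apply_self (G x)) continuous_const).inter
      (isClosed_le (G x w).continuous continuous_const)
  obtain ⟨c, hc, hcK⟩ : ∃ c > 0, ∀ u ∈ K, c < A x u := by
    rcases K.eq_empty_or_nonempty with h | h
    · exact ⟨1, one_pos, by simp [h]⟩
    · obtain ⟨u, hu, hmin⟩ := hKc.exists_isMinOn h (A x).continuous.continuousOn
      have hu0 : 0 < A x u := hpos u (by
        rintro rfl
        simpa using hu.1) hu.2.1 hu.2.2
      exact ⟨A x u / 2, half_pos hu0, fun z hz => (half_lt_self hu0).trans_le (hmin hz)⟩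
  refine ⟨c, hc, ?_⟩
  have hGq : ∀ u : E, ContinuousAt (fun p : X × E => G p.1 p.2 p.2) (x, u) := fun u =>
    ((hG.comp continuousAt_fst).clm_apply continuousAt_snd).clm_apply continuousAt_snd
  have hGw : ∀ u : E, ContinuousAt (fun p : X × E => G p.1 w p.2) (x, u) := fun u =>
    ((hG.comp continuousAt_fst).clm_apply continuousAt_const).clm_apply continuousAt_snd
  have hAu : ∀ u : E, ContinuousAt (fun p : X × E => A p.1 p.2) (x, u) := fun u =>
    (hA.comp continuousAt_fst).clm_apply continuousAt_snd
  -- Each unit vector either violates a cone inequality at x or satisfies the strict bound. All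
  -- three are open conditions in the pair (y, u), so compactness of the sphere gives one
  -- neighbourhood of x.
  have key := hcompact.eventually_forall_of_forall_eventually (x₀ := x)
    (P := fun y u => G y u u ≤ 0 → G y w u ≤ 0 → c < A y u) (by
      intro u hu
      by_cases h1 : G x u u ≤ 0
      · by_cases h2 : G x w u ≤ 0
        · filter_upwards [(hAu u).eventually (lt_mem_nhds (hcK u ⟨hu, h1, h2⟩))] with p hp _ _
            using hp
        · filter_upwards [(hGw u).eventually (lt_mem_nhds (not_le.1 h2))] with p hp _ h
            using absurd h hp.not_ge
      · filter_upwards [(hGq u).eventually (lt_mem_nhds (not_le.1 h1))] with p hp h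
          using absurd h hp.not_ge)
  filter_upwards [key] with y hy u h1 h2
  rcases eq_or_ne u 0 with rfl | hu
  · simp
  have hn : 0 < ‖u‖ := norm_pos_iff.2 hu
  have := hy (‖u‖⁻¹ • u) (by simp [norm_smul, hn.ne'])
    (by
      simp only [map_smul, smul_apply, smul_eq_mul, ← mul_assoc]
      exact mul_nonpos_of_nonneg_of_nonpos (by positivity) h1)
    (by
      rw [map_smul, smul_eq_mul]
      exact mul_nonpos_of_nonneg_of_nonpos (by positivity) h2)
  rw [map_smul, smul_eq_mul, inv_mul_eq_div, lt_div_iff₀ hn] at this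
  exact this.le

end ConeEstimate

/-! ### Metrics and vector fields in a fixed chart. -/

section Coordinates

variable {n : ℕ} {M : Type*} [TopologicalSpace M] [ChartedSpace (Euc n) M]
  [IsManifold (𝓡 n) ∞ M]

/-- Moves the metric to one fixed vector space, where continuity in the base point can feed the cone
estimate. -/
theorem IsSmoothSymm.exists_coordinates {g : Tensor02 n M} (hg : IsSmoothSymm g) (x : M) :
    ∃ G : M → Euc n →L[ℝ] Euc n →L[ℝ] ℝ, ContinuousAt G x ∧
      ∀ y ∈ (chartAt (Euc n) x).source, ∀ v w : TangentSpace (𝓡 n) y,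
        g y v w = G y (chartDeriv x y v) (chartDeriv x y w) := by
  have h := (contMDiffAt_hom_bundle _).1 (hg.smooth x)
  refine ⟨_, h.2.continuousAt, fun y hy v w => ?_⟩
  have hy' : y ∈ (trivializationAt (Euc n) (TangentSpace (𝓡 n)) x).baseSet := by simpa using hy
  have hsymm : ∀ v : TangentSpace (𝓡 n) y,
      (trivializationAt (Euc n) (TangentSpace (𝓡 n)) x).symm y
        (chartDeriv x y v) = v := by
    intro v
    rw [chartDeriv, ← TangentBundle.continuousLinearMapAt_trivializationAt hy]
    exact (Bundle.Trivialization.symmL_apply (R := ℝ) _ hy' _).symm.trans <|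
      Bundle.Trivialization.symmL_continuousLinearMapAt (R := ℝ)
      (trivializationAt (Euc n) (TangentSpace (𝓡 n) : M → Type _) x) hy' v
  rw [inCoordinates_apply_eq₂ hy' hy' (Set.mem_univ _), hsymm, hsymm]
  simp

theorem SmoothVFieldOn.continuousAt_coordinates {X : VField n M} {U : Set M}
    (hX : SmoothVFieldOn X U) {x : M} (hU : U ∈ nhds x) :
    ContinuousAt (fun y => chartDeriv x y (X y)) x := by
  have h := (Bundle.contMDiffAt_totalSpace.1 (hX.contMDiffAt hU)).2.continuousAt
  refine h.congr ?_
  filter_upwards [(chartAt (Euc n) x).open_source.mem_nhds (mem_chart_source _ x)] with y hy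
  have hy' : y ∈ (trivializationAt (Euc n) (TangentSpace (𝓡 n)) x).baseSet := by simpa using hy
  rw [chartDeriv, ← TangentBundle.continuousLinearMapAt_trivializationAt hy]
  exact (congrFun (Bundle.Trivialization.coe_linearMapAt_of_mem (R := ℝ)
    (trivializationAt (Euc n) (TangentSpace (𝓡 n) : M → Type _) x) hy') (X y)).symm

end Coordinates

theorem chartDeriv_surjective {n : ℕ} {M : Type*} [TopologicalSpace M] [ChartedSpace (Euc n) M]
    [IsManifold (𝓡 n) ∞ M] {x y : M} (hy : y ∈ (chartAt (Euc n) x).source) :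
    Function.Surjective (chartDeriv (n := n) x y) := by
  have : IsManifold (𝓡 n) 1 M := .of_le (n := ∞) (by simp)
  obtain ⟨e, he⟩ := isInvertible_mfderiv_extChartAt (I := 𝓡 n) (x := x) (y := y) (by simpa using hy)
  intro u
  obtain ⟨v, hv⟩ := e.surjective u
  exact ⟨v, (congrArg (fun L => L v) he).symm.trans hv⟩

/-! ### Separation in the leaf space; the local temporal function. -/

namespace Foliation

variable {ι : Type*} {n q : ℕ} {M : Type*} [TopologicalSpace M] [ChartedSpace (Euc n) M]

/-- In a Hausdorff leaf space, a leaf and a compact set disjoint from it are separated by a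
saturated open neighbourhood of the leaf. -/
theorem exists_saturated_disjoint (F : Foliation ι n q M) (hH : T2Space F.LeafSpace) {x : M}
    {K : Set M} (hK : IsCompact K) (hd : Disjoint (F.leaf x) K) :
    ∃ U, IsOpen U ∧ F.IsSaturated U ∧ F.leaf x ⊆ U ∧ Disjoint U K := by
  let p : M → F.LeafSpace := Quotient.mk F.leafSetoid
  have hp : Continuous p := continuous_quotient_mk'
  have hx : Disjoint {p x} (p '' K) := by
    rw [Set.disjoint_singleton_left]
    rintro ⟨y, hy, hyx⟩
    exact Set.disjoint_left.1 hd (F.leafSetoid.symm (Quotient.exact hyx)) hy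
  obtain ⟨A, B, hA, hB, hxA, hKB, hAB⟩ :=
    SeparatedNhds.of_isCompact_isCompact isCompact_singleton (hK.image hp) hx
  refine ⟨p ⁻¹' A, hA.preimage hp, fun y hy z hz => ?_, fun z hz => ?_, ?_⟩
  · change p z ∈ A
    rwa [show p z = p y from (Quotient.sound hz).symm]
  · change p z ∈ A
    rw [show p z = p x from (Quotient.sound hz).symm]
    exact hxA rfl
  · exact Set.disjoint_left.2 fun z hz hzK => Set.disjoint_left.1 hAB hz (hKB ⟨z, hzK, rfl⟩)

variable [IsManifold (𝓡 n) ∞ M] {F : Foliation ι n q M} {gT g : Tensor02 n M} {T Tg : ConeField n M}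

/-- The composition of a submersion of the cocycle with a linear form, in the preferred chart
at `x`. -/
def chartForm (F : Foliation ι n q M) (i : ι) (l : Euc q →L[ℝ] ℝ) (x : M) : Euc n → ℝ :=
  fun z => l (F.π i ((extChartAt (𝓡 n) x).symm z))

theorem contDiffAt_chartForm {i : ι} {x : M} (hx : x ∈ F.U i) (l : Euc q →L[ℝ] ℝ) :
    ContDiffAt ℝ ∞ (F.chartForm i l x) (extChartAt (𝓡 n) x x) := by
  rw [← contMDiffAt_iff_contDiffAt]
  have h1 : ContMDiffAt 𝓘(ℝ, Euc n) (𝓡 n) ∞ (extChartAt (𝓡 n) x).symm (extChartAt (𝓡 n) x x) :=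
    (contMDiffOn_extChartAt_symm x).contMDiffAt (extChartAt_target_mem_nhds x)
  have h2 : ContMDiffAt (𝓡 n) (𝓡 q) ∞ (F.π i)
      ((extChartAt (𝓡 n) x).symm (extChartAt (𝓡 n) x x)) := by
    rw [extChartAt_to_inv]
    exact (F.smooth_π i).contMDiffAt ((F.isOpen_U i).mem_nhds hx)
  exact l.contMDiff.contMDiffAt.comp _ (h2.comp _ h1)

theorem fderiv_chartForm {i : ι} {x : M} (hx : x ∈ F.U i) (l : Euc q →L[ℝ] ℝ)
    (v : TangentSpace (𝓡 n) x) :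
    fderiv ℝ (F.chartForm i l x) (extChartAt (𝓡 n) x x) (chartDeriv x x v) =
      l (mfderiv (𝓡 n) (𝓡 q) (F.π i) x v) := by
  have hf : HasMFDerivAt 𝓘(ℝ, Euc n) 𝓘(ℝ) (F.chartForm i l x) (extChartAt (𝓡 n) x x)
      (fderiv ℝ (F.chartForm i l x) (extChartAt (𝓡 n) x x)) :=
    ((contDiffAt_chartForm hx l).differentiableAt (by simp)).hasFDerivAt.hasMFDerivAt
  have h1 := hf.comp x (hasMFDerivAt_chartDeriv (mem_chart_source _ x))
  have hπ : HasMFDerivAt (𝓡 n) (𝓡 q) (F.π i) x (mfderiv (𝓡 n) (𝓡 q) (F.π i) x) :=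
    (((F.smooth_π i).contMDiffAt
      ((F.isOpen_U i).mem_nhds hx)).mdifferentiableAt (by simp)).hasMFDerivAt
  have h2 := (l.hasMFDerivAt (x := F.π i x)).comp x hπ
  have h3 := h2.congr_of_eventuallyEq (f₁ := F.chartForm i l x ∘ extChartAt (𝓡 n) x) <| by
    filter_upwards [extChartAt_source_mem_nhds (I := 𝓡 n) x] with y hy
    simp only [chartForm, Function.comp_apply, (extChartAt (𝓡 n) x).left_inv hy]
  exact congrArg (fun L => L v) (hasMFDerivAt_unique h1 h3)

/-- The horizontal part of a future timelike vector is timelike, in the same half of the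
timelike vectors, and orthogonal to the leaf. -/
theorem IsBundleLike.exists_horizontal (hgb : F.IsBundleLike gT g) (hg : IsLorentzMetric g)
    (hT : IsTimeOrientation gT T) (hTgT : ∀ x, Tg x ⊆ T x) {x : M} {v : TangentSpace (𝓡 n) x}
    (hv : v ∈ Tg x) : ∃ y, g x y y < 0 ∧ g x y v < 0 ∧ ∀ t ∈ F.tangent x, g x y t = 0 := by
  -- The witness y is the horizontal part of v: g(y, v) = g(y, y) = gT(v, v) < 0.
  obtain ⟨t, ht, y, hy, hty⟩ := Submodule.mem_sup.1
    ((hgb.adapted x).sup_eq_top ▸ Submodule.mem_top (x := v))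
  have hvy : v - y ∈ F.tangent x := by rwa [← hty, add_sub_cancel_right]
  have hneg : gT x v v < 0 := hT.subset_timelikeSet x (hTgT x hv)
  rw [hgb.associated x v v y y hy hvy hy hvy] at hneg
  have horth : ∀ t ∈ F.tangent x, g x y t = 0 := fun t ht => by
    rw [hg.smoothSymm.symm]
    exact hy t ht
  refine ⟨y, hneg, ?_, horth⟩
  rwa [← hty, map_add, horth t ht, zero_add]

/-- Future causal vectors of a bundle-like metric are future transversely causal. -/
theorem IsBundleLike.futureCausalCone_subset (hgb : F.IsBundleLike gT g) (hg : IsLorentzMetric g)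
    (hT : IsTimeOrientation gT T) (hTg : IsTimeOrientation g Tg) (hTgT : ∀ x, Tg x ⊆ T x) (x : M) :
    futureCausalCone Tg x ⊆ F.futureCausalWedge T x := by
  rintro v ⟨hv, hv0⟩
  refine ⟨closure_mono (hTgT x) hv, fun hvF => ?_⟩
  obtain ⟨U, -, hxU, X, -, hX⟩ := hTg.smooth x
  -- A nonzero leaf vector is orthogonal to this timelike y, hence spacelike, and so not causal.
  obtain ⟨y, hyy, hyX, hy⟩ := hgb.exists_horizontal hg hT hTgT (hX x hxU)
  exact (hg.pos_of_orthogonal hyy (hy v hvF) hv0).not_ge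
    (hTg.nonpos_of_mem_closure hg hyy (hX x hxU) hyX hv).1

/-- Near each point, a bundle-like Lorentzian metric admits a temporal function that is constant
along the plaques and whose derivative dominates the chart norm of future causal vectors. -/
theorem IsBundleLike.exists_chartForm_temporal (hgb : F.IsBundleLike gT g) (hg : IsLorentzMetric g)
    (hT : IsTimeOrientation gT T) (hTg : IsTimeOrientation g Tg) (hTgT : ∀ x, Tg x ⊆ T x)
    {i : ι} {x : M} (hx : x ∈ F.U i) :
    ∃ l : Euc q →L[ℝ] ℝ, ∃ c > 0, ∀ᶠ y in nhds x, ∀ v ∈ closure (Tg y),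
      c * ‖chartDeriv x y v‖ ≤
        fderiv ℝ (F.chartForm i l x) (extChartAt (𝓡 n) x y) (chartDeriv x y v) := by
  obtain ⟨U, hU, hxU, X, hXs, hX⟩ := hTg.smooth x
  obtain ⟨w, hww, hwX, hw⟩ := hgb.exists_horizontal hg hT hTgT (hX x hxU)
  -- Since w is orthogonal to the leaf, this covector vanishes on ker dπ_i and so factors through
  -- dπ_i.
  have hlin : -(g x w).toLinearMap ∈
      LinearMap.range (mfderiv (𝓡 n) (𝓡 q) (F.π i) x).toLinearMap.dualMap := by
    rw [LinearMap.range_dualMap_eq_dualAnnihilator_ker, Submodule.mem_dualAnnihilator]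
    intro v hv
    have := hw v (F.mem_tangent_of_mfderiv_eq_zero hx hv)
    simpa using this
  obtain ⟨l', hl'⟩ := hlin
  let l : Euc q →L[ℝ] ℝ := LinearMap.toContinuousLinearMap (E := Euc q) l'
  have hl : ∀ v, l (mfderiv (𝓡 n) (𝓡 q) (F.π i) x v) = -g x w v := fun v =>
    congrArg (fun L => L v) hl'
  obtain ⟨G, hG, hGg⟩ := hg.smoothSymm.exists_coordinates x
  have hxs := mem_chart_source (Euc n) x
  have hA : ContinuousAt (fun y => fderiv ℝ (F.chartForm i l x) (extChartAt (𝓡 n) x y)) x :=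
    ContinuousAt.comp (f := extChartAt (𝓡 n) x)
      ((contDiffAt_chartForm hx l).fderiv_right (m := 0) (by simp)).continuousAt
      (continuousAt_extChartAt x)
  obtain ⟨c, hc, hev⟩ := exists_eventually_mul_norm_le hG hA (chartDeriv x x w) (by
    intro u hu h1 h2
    obtain ⟨v, rfl⟩ := chartDeriv_surjective hxs u
    rw [← hGg x hxs] at h1 h2
    rw [fderiv_chartForm hx, hl]
    have hv : v ≠ 0 := by
      rintro rfl
      exact hu (map_zero _)
    refine neg_pos.2 (h2.lt_of_ne fun h => ?_)
    exact (hg.pos_of_orthogonal hww h hv).not_ge h1)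
  refine ⟨l, c, hc, ?_⟩
  -- The constant coordinate extension of w stays timelike and keeps its negative product with X, so
  -- near x the future cones satisfy the inequalities of the cone estimate.
  have hww' : ∀ᶠ y in nhds x, G y (chartDeriv x x w) (chartDeriv x x w) < 0 := by
    refine ((hG.clm_apply continuousAt_const).clm_apply continuousAt_const).eventually
      (gt_mem_nhds ?_)
    simpa only [← hGg x hxs]
  have hwX' : ∀ᶠ y in nhds x, G y (chartDeriv x x w) (chartDeriv x y (X y)) < 0 := by
    refine ((hG.clm_apply continuousAt_const).clm_apply
      (hXs.continuousAt_coordinates (hU.mem_nhds hxU))).eventually (gt_mem_nhds ?_)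
    simpa only [← hGg x hxs]
  filter_upwards [hev, hww', hwX', hU.mem_nhds hxU,
    (chartAt (Euc n) x).open_source.mem_nhds hxs] with y hy h1 h2 hyU hys v hv
  obtain ⟨z, hz⟩ := chartDeriv_surjective hys (chartDeriv x x w)
  rw [← hz, ← hGg y hys] at h1 h2
  obtain ⟨h3, h4⟩ := hTg.nonpos_of_mem_closure hg h1 (hX y hyU) h2 hv
  rw [hGg y hys] at h3 h4
  exact hy _ h3 (hz ▸ h4)

end Foliation

end LorFol

end

/-! ### Strong causality. -/

theorem proposition5p15 {n q : ℕ} {ι M : Type*} [TopologicalSpace M] [T2Space M]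
    [SecondCountableTopology M] [ConnectedSpace M] [ChartedSpace (Euc n) M]
    [IsManifold (𝓡 n) ∞ M]
    (F : LorFol.Foliation ι n q M)
    (gT : LorFol.Tensor02 n M) (hgT : F.IsLorentzTransverseMetric gT)
    (T : LorFol.ConeField n M) (hT : LorFol.IsTimeOrientation gT T)
    (hcausal : F.IsTransverselyStronglyCausal T)
    (hHausdorff : T2Space F.LeafSpace)
    (g : LorFol.Tensor02 n M) (hg : LorFol.IsLorentzMetric g) (hgb : F.IsBundleLike gT g)
    (Tg : LorFol.ConeField n M) (hTg : LorFol.IsTimeOrientation g Tg)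
    (hTgT : ∀ x : M, Tg x ⊆ T x) :
    LorFol.IsStronglyCausal Tg := by
  intro x U hU hxU
  obtain ⟨i, hxi⟩ := F.cover x
  obtain ⟨l, c, hc, hev⟩ := hgb.exists_chartForm_temporal hg hT hTg hTgT hxi
  set f := F.chartForm i l x with hf
  set φ := extChartAt (𝓡 n) x with hφ
  have hcont : ∀ᶠ z in nhds (φ x), ContDiffAt ℝ 1 f z :=
    ((LorFol.Foliation.contDiffAt_chartForm hxi l).of_le (by simp)).eventually (by simp)
  have hsymm : Filter.Tendsto φ.symm (nhds (φ x)) (nhds x) := by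
    simpa only [hφ, ContinuousAt, extChartAt_to_inv] using
      continuousAt_extChartAt_symm (I := 𝓡 n) x
  obtain ⟨R, hR, hball⟩ := Metric.nhds_basis_closedBall.mem_iff.1 <|
    Filter.inter_mem (extChartAt_target_mem_nhds (I := 𝓡 n) x) <|
    Filter.inter_mem hcont <| Filter.inter_mem (hsymm.eventually hev) <|
    Filter.inter_mem (hsymm ((F.isOpen_U i).mem_nhds hxi)) (hsymm (hU.mem_nhds hxU))
  obtain ⟨r, hr, rfl⟩ : ∃ r, 0 < r ∧ R = 2 * r := ⟨R / 2, by linarith, by ring⟩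
  set D := Metric.closedBall (φ x) (2 * r) with hD
  have hDt : ∀ z ∈ D, z ∈ φ.target := fun z hz => (hball hz).1
  have hDf : ∀ z ∈ D, ContDiffAt ℝ 1 f z := fun z hz => (hball hz).2.1
  have hDφ : ∀ z ∈ D, φ (φ.symm z) = z := fun z hz => φ.right_inv (hDt z hz)
  have hDi : ∀ z ∈ D, φ.symm z ∈ F.U i := fun z hz => (hball hz).2.2.2.1
  have hfD : ContinuousOn f D := fun z hz => (hDf z hz).continuousAt.continuousWithinAt
  have hsymmD : ContinuousOn φ.symm D := (continuousOn_extChartAt_symm x).mono hDt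
  have hDc : IsCompact D := isCompact_closedBall _ _
  set B := φ.symm '' D with hB
  have hBc : IsClosed B := (hDc.image_of_continuousOn hsymmD).isClosed
  have hopen : ∀ ρ, IsOpen (φ.source ∩ φ ⁻¹' Metric.ball (φ x) ρ) := fun ρ =>
    (continuousOn_extChartAt x).isOpen_inter_preimage (isOpen_extChartAt_source x)
      Metric.isOpen_ball
  set O := φ.source ∩ φ ⁻¹' Metric.ball (φ x) (2 * r) with hO
  have hOB : O ⊆ B := fun y hy =>
    ⟨φ y, Metric.ball_subset_closedBall hy.2, φ.left_inv hy.1⟩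
  have hOU : O ⊆ U := by
    intro y hy
    have := (hball (Metric.ball_subset_closedBall hy.2)).2.2.2.2
    rwa [Set.mem_preimage, φ.left_inv hy.1] at this
  by_contra! hbad
  -- The curve will start with f above f(φ x) - c * r / 2 and gain at least c * r, so it passes
  -- every s in this interval that exceeds its initial value.
  have hmem : ∀ s ∈ Set.Ioo (f (φ x)) (f (φ x) + c * r / 2),
      s ∈ l '' (F.π i '' (F.leaf x ∩ F.U i)) := by
    intro s hs
    by_contra hsn
    set K := φ.symm '' (D ∩ f ⁻¹' {s}) with hK
    have hKc : IsCompact K := by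
      refine IsCompact.image_of_continuousOn ?_ (hsymmD.mono Set.inter_subset_left)
      exact hDc.of_isClosed_subset
        (hfD.preimage_isClosed_of_isClosed hDc.isClosed isClosed_singleton) Set.inter_subset_left
    have hLK : Disjoint (F.leaf x) K := by
      rw [Set.disjoint_left]
      rintro _ hy ⟨z, ⟨hz, hzs⟩, rfl⟩
      exact hsn ⟨_, ⟨_, ⟨hy, hDi z hz⟩, rfl⟩, hzs⟩
    obtain ⟨W, hW, hWs, hLW, hWK⟩ := F.exists_saturated_disjoint hHausdorff hKc hLK
    obtain ⟨V₀, hV₀, hLV₀, -, hV₀c⟩ := hcausal x W hW hWs hLW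
    have hfx : ∀ᶠ z in nhds (φ x), f z ∈ Set.Ioo (f (φ x) - c * r / 2) s :=
      (hDf _ (Metric.mem_closedBall_self (by positivity))).continuousAt.eventually
        (Ioo_mem_nhds (by linarith [mul_pos hc hr]) hs.1)
    obtain ⟨ρ, hρ, hρf⟩ := Metric.eventually_nhds_iff_ball.1 hfx
    have hVO : φ.source ∩ φ ⁻¹' Metric.ball (φ x) (min ρ r) ⊆ O := fun y hy =>
      ⟨hy.1, Metric.ball_subset_ball ((min_le_right _ _).trans (by linarith)) hy.2⟩
    obtain ⟨γ, a, b, hγ, ha, hb, hγU⟩ := hbad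
      (V₀ ∩ (φ.source ∩ φ ⁻¹' Metric.ball (φ x) (min ρ r))) (hV₀.inter (hopen _))
      ⟨hLV₀ (F.leafSetoid.refl x), mem_extChartAt_source x, Metric.mem_ball_self (lt_min hρ hr)⟩
      fun y hy => hOU (hVO hy.2)
    have hγW := hV₀c γ a b (hγ.mono (hgb.futureCausalCone_subset hg hT hTg hTgT)) ha.1 hb.1
    have hγc := hγ.continuousOn
    obtain ⟨_, ⟨t₀, ht₀, rfl⟩, ht₀U⟩ := Set.not_subset.1 hγU
    have hSc : IsCompact (Set.Icc a b ∩ γ ⁻¹' Oᶜ) := isCompact_Icc.of_isClosed_subset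
      (hγc.preimage_isClosed_of_isClosed isClosed_Icc (hopen _).isClosed_compl)
      Set.inter_subset_left
    obtain ⟨t₁, ⟨ht₁, ht₁O⟩, hleast⟩ := hSc.exists_isLeast ⟨t₀, ht₀, fun h => ht₀U (hOU h)⟩
    have hat₁ : a < t₁ := ht₁.1.lt_of_ne fun h => ht₁O (h ▸ hVO ha.2)
    have hlt : ∀ t ∈ Set.Ico a t₁, γ t ∈ O := by
      intro t ht
      by_contra h
      exact (hleast ⟨⟨ht.1, ht.2.le.trans ht₁.2⟩, h⟩).not_gt ht.2
    have hγ₁ : ContinuousOn γ (Set.Icc a t₁) := hγc.mono (Set.Icc_subset_Icc_right ht₁.2)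
    -- At the exit time the curve has left O; closedness of B, a compact set in a Hausdorff space,
    -- keeps that point in the chart.
    have hγB : ∀ t ∈ Set.Icc a t₁, γ t ∈ B := by
      intro t ht
      rw [← closure_Ico hat₁.ne] at hγ₁ ht
      refine hBc.closure_subset_iff.2 ?_ (hγ₁.image_closure ⟨t, ht, rfl⟩)
      rintro _ ⟨t, ht, rfl⟩
      exact hOB (hlt t ht)
    have hBs : ∀ y ∈ B, y ∈ φ.source ∧ φ y ∈ D ∧ φ.symm (φ y) = y := by
      rintro _ ⟨z, hz, rfl⟩
      rw [hDφ z hz]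
      exact ⟨φ.map_target (hDt z hz), hz, rfl⟩
    have hγD : ∀ t ∈ Set.Icc a t₁, φ (γ t) ∈ D := fun t ht => (hBs _ (hγB t ht)).2.1
    have hgrow := hγ.le_sub (x := x) (f := f) hc ht₁
      (fun t ht => by simpa [hφ] using (hBs _ (hγB t ht)).1)
      (fun t ht => (hDf _ (hγD t ht)).differentiableAt (by simp))
      (fun t ht v hv => by
        have := (hball (hγD t ht)).2.2.1
        rw [Set.mem_ofPred_eq, (hBs _ (hγB t ht)).2.2] at this
        exact this v hv.1)
    have hfar : 2 * r ≤ dist (φ (γ t₁)) (φ x) := by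
      by_contra! h
      exact ht₁O ⟨(hBs _ (hγB t₁ (Set.right_mem_Icc.2 hat₁.le))).1, h⟩
    have hnear : dist (φ (γ a)) (φ x) < r := lt_of_lt_of_le ha.2.2 (min_le_right _ _)
    have hfa := hρf (φ (γ a)) (Metric.ball_subset_ball (min_le_left _ _) ha.2.2)
    have hdist : r ≤ ‖φ (γ t₁) - φ (γ a)‖ := by
      rw [← dist_eq_norm]
      linarith [dist_triangle (φ (γ t₁)) (φ (γ a)) (φ x)]
    have hst₁ : s ≤ f (φ (γ t₁)) := by
      linarith [hs.2, hfa.1, mul_le_mul_of_nonneg_left hdist hc.le]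
    have hfγ : ContinuousOn (fun t => f (φ (γ t))) (Set.Icc a t₁) :=
      hfD.comp ((continuousOn_extChartAt x).comp hγ₁ fun t ht => (hBs _ (hγB t ht)).1) hγD
    obtain ⟨t, ht, hts⟩ := intermediate_value_Icc hat₁.le hfγ ⟨hfa.2.le, hst₁⟩
    exact Set.disjoint_left.1 hWK (hγW ⟨t, ⟨ht.1, ht.2.trans ht₁.2⟩, rfl⟩)
      ⟨φ (γ t), ⟨hγD t ht, hts⟩, (hBs _ (hγB t ht)).2.2⟩
  have := ((F.countable_image_leaf i x).image l).mono hmem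
  rw [Cardinal.Real.Ioo_countable_iff] at this
  linarith [mul_pos hc hr]
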